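/- Let $d\ge 0$ be an integer, let $E=\mathbb{Q}^2$, and let $S(2,d)$ be the Schur algebra over $\mathbb{Q}$, that is, the image of the group algebra $\mathbb{Q}\,\mathsf{GL}_2(\mathbb{Q})$ in $\operatorname{End}_{\mathbb{Q}}(E^{\otimes d})$ under the diagonal action $g(v_1\otimes\cdots\otimes v_d)=gv_1\otimes\cdots\otimes gv_d$. Then $S(2,d)$ is isomorphic, as a unital $\mathbb{Q}$-algebra, to the unital associative $\mathbb{Q}$-algebra generated by $e,f,h$ subject to the relations $$he-eh=2e,\qquad ef-fe=h,\qquad hf-fh=-2f,$$ $$(h+d)(h+d-2)\cdots(h-d+2)(h-d)=0,$$ where the last product is $\prod_{i=0}^{d}(h+d-2i)$. An isomorphism can be chosen so that it sends $e,f,h$ to the operators $v_1\otimes\cdots\otimes v_d\mapsto\sum_{i=1}^d v_1\otimes\cdots\otimes xv_i\otimes\cdots\otimes v_d$ on $E^{\otimes d}$ with $x=\begin{pmatrix}0&1\\0&0\end{pmatrix},\begin{pmatrix}0&0\\1&0\end{pmatrix},\begin{pmatrix}1&0\\0&-1\end{pmatrix}$, respectively. Moreover, the elements $f^a h^b e^c$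 with $a,b,c\ge 0$ integers and $a+b+c\le d$ form a $\mathbb{Q}$-basis of the presented algebra (in particular, they are pairwise distinct). -/

import Mathlib

open scoped TensorProduct

noncomputable section

namespace SchurTwo

/-- The natural two-dimensional module `E = ℚ²` with its standard basis. -/
abbrev E : Type := Fin 2 → ℚ

/-- The tensor space `E^{⊗ d}`. -/
abbrev TensorSpace (d : ℕ) : Type := ⨂[ℚ]^d E

/-- The diagonal action `σ_d` of `GL₂(ℚ)` on tensor space:
`g • (v₁ ⊗ ⋯ ⊗ v_d) = g v₁ ⊗ ⋯ ⊗ g v_d`. -/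
def groupRep (d : ℕ) : Representation ℚ (GL (Fin 2) ℚ) (TensorSpace d) where
  toFun g := PiTensorProduct.map fun _ : Fin d => Matrix.toLin' (g : Matrix (Fin 2) (Fin 2) ℚ)
  map_one' := by
    simp only [Units.val_one, Matrix.toLin'_one]
    exact PiTensorProduct.map_id
  map_mul' g k := by
    simp only [Units.val_mul, Matrix.toLin'_mul]
    exact PiTensorProduct.map_comp _ _

/-- The Schur algebra `S(2,d)` over `ℚ`: the image of the group algebra `ℚ GL₂(ℚ)` in
`End(E^{⊗ d})`. -/
def schurAlgebra (d : ℕ) : Subalgebra ℚ (Module.End ℚ (TensorSpace d)) :=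
  (groupRep d).asAlgebraHom.range

/-- The action `ρ_d` of `𝔤𝔩₂(ℚ)` on tensor space (the derivative of `σ_d`):
`x • (v₁ ⊗ ⋯ ⊗ v_d) = ∑ i, v₁ ⊗ ⋯ ⊗ x vᵢ ⊗ ⋯ ⊗ v_d`. -/
def lieAction (d : ℕ) (x : Matrix (Fin 2) (Fin 2) ℚ) : Module.End ℚ (TensorSpace d) :=
  ∑ i : Fin d, PiTensorProduct.map
    (Function.update (fun _ : Fin d => (LinearMap.id : E →ₗ[ℚ] E)) i (Matrix.toLin' x))

/-- The three generating symbols. -/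
inductive Gen : Type
  | e
  | f
  | h

/-- The free unital associative `ℚ`-algebra on the three symbols. -/
abbrev Free : Type := FreeAlgebra ℚ Gen

/-- The symbol `e` in the free algebra. -/
def Free.e : Free := FreeAlgebra.ι ℚ Gen.e

/-- The symbol `f` in the free algebra. -/
def Free.f : Free := FreeAlgebra.ι ℚ Gen.f

/-- The symbol `h` in the free algebra. -/
def Free.h : Free := FreeAlgebra.ι ℚ Gen.h

/-- The defining relations: the three relations of `𝔰𝔩₂`, and
`(h + d)(h + d - 2) ⋯ (h - d + 2)(h - d) = 0`. -/
inductive Rel (d : ℕ) : Free → Free → Prop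
  | he : Rel d (Free.h * Free.e - Free.e * Free.h) (2 * Free.e)
  | ef : Rel d (Free.e * Free.f - Free.f * Free.e) Free.h
  | hf : Rel d (Free.h * Free.f - Free.f * Free.h) (-(2 * Free.f))
  | prod : Rel d
      ((List.range (d + 1)).map fun i => Free.h + algebraMap ℚ Free ((d : ℚ) - 2 * (i : ℚ))).prod 0

/-- The unital associative `ℚ`-algebra generated by `e, f, h` subject to the relations `Rel d`. -/
abbrev Presented (d : ℕ) : Type := RingQuot (Rel d)

/-- The generator `e` of the presented algebra. -/
def Presented.e (d : ℕ) : Presented d := RingQuot.mkAlgHom ℚ (Rel d) Free.e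

/-- The generator `f` of the presented algebra. -/
def Presented.f (d : ℕ) : Presented d := RingQuot.mkAlgHom ℚ (Rel d) Free.f

/-- The generator `h` of the presented algebra. -/
def Presented.h (d : ℕ) : Presented d := RingQuot.mkAlgHom ℚ (Rel d) Free.h

end SchurTwo

end

/-! Let N be the number of triples (a, b, c) with a + b + c ≤ d. The proof is the dimension squeeze
N ≤ dim S(2,d) ≤ dim(image of the presented algebra) ≤ dim(presented algebra) ≤ N.

Upper bound: filter the presented algebra by F_n, the n-th power of the span of 1, e, f, h. Each F_n
is stable under commutators with e, f, h. The last relation puts h^(d+1) in F_d. Bracketing with e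
and then with f turns factors h into e or f up to nonzero scalars, so every ordered monomial of
degree d + 1 lies in F_d (`IsTriple.monomial_mem`). With PBW straightening, the filtration stops at
F_d and the monomials of degree at most d span.

Middle: the relations hold on tensor space, and the image contains every group element. A matrix is
a product of transvections, which act as exponentials of nilpotents, and diagonal matrices, which
act as polynomials in h (`mulAction_mem`).

Lower bound: the N monomials of degree d in the four matrix entries are matrix coefficients of
tensor space. They are independent on GL₂(ℚ), which is Zariski dense, so they give N independent
functionals on S(2,d). -/

namespace SchurTwo

/-! ### The filtration and the upper bound by ordered monomials -/

section Filtration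

variable {A : Type*} [Ring A] [Algebra ℚ A]

/-- The commutation relations of the standard basis of `𝔰𝔩₂`. -/
structure IsTriple (e f h : A) : Prop where
  he : h * e - e * h = 2 * e
  ef : e * f - f * e = h
  hf : h * f - f * h = -(2 * f)

/-- The span of `1, e, f, h`; its powers filter the algebra generated by `e, f, h`. -/
def genSpan (e f h : A) : Submodule ℚ A := Submodule.span ℚ {1, e, f, h}

variable {e f h : A}

lemma one_mem_genSpan : (1 : A) ∈ genSpan e f h := Submodule.subset_span (by simp)
lemma e_mem_genSpan : e ∈ genSpan e f h := Submodule.subset_span (by simp)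
lemma f_mem_genSpan : f ∈ genSpan e f h := Submodule.subset_span (by simp)
lemma h_mem_genSpan : h ∈ genSpan e f h := Submodule.subset_span (by simp)

lemma genSpan_pow_mono {m n : ℕ} (hmn : m ≤ n) : genSpan e f h ^ m ≤ genSpan e f h ^ n :=
  pow_le_pow_right₀ (Submodule.one_le.2 one_mem_genSpan) hmn

lemma mul_mem_genSpan_pow {x y : A} {m n k : ℕ} (hx : x ∈ genSpan e f h ^ m)
    (hy : y ∈ genSpan e f h ^ n) (hk : m + n ≤ k) : x * y ∈ genSpan e f h ^ k :=
  genSpan_pow_mono hk (by rw [pow_add]; exact Submodule.mul_mem_mul hx hy)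

lemma pow_mem_genSpan_pow {x : A} (hx : x ∈ genSpan e f h) (n : ℕ) :
    x ^ n ∈ genSpan e f h ^ n := Submodule.pow_mem_pow _ hx n

lemma mem_genSpan_pow_one {x : A} (hx : x ∈ genSpan e f h) : x ∈ genSpan e f h ^ 1 := by
  rwa [pow_one]

/-- A commutator of elements of `genSpan` lies in `genSpan`. -/
lemma IsTriple.commutator_mem_genSpan (t : IsTriple e f h) {x y : A}
    (hx : x ∈ genSpan e f h) (hy : y ∈ genSpan e f h) : x * y - y * x ∈ genSpan e f h := by
  have he : e ∈ genSpan e f h := e_mem_genSpan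
  have hf : f ∈ genSpan e f h := f_mem_genSpan
  have hh : h ∈ genSpan e f h := h_mem_genSpan
  have two : ∀ z : A, 2 * z = (2 : ℚ) • z := fun z => by rw [two_smul, two_mul]
  have h1 : h * e - e * h ∈ genSpan e f h := by
    rw [t.he, two]; exact Submodule.smul_mem _ _ he
  have h2 : e * f - f * e ∈ genSpan e f h := by rw [t.ef]; exact hh
  have h3 : h * f - f * h ∈ genSpan e f h := by
    rw [t.hf, two]; exact Submodule.neg_mem _ (Submodule.smul_mem _ _ hf)
  have h1' := Submodule.neg_mem _ h1
  have h2' := Submodule.neg_mem _ h2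
  have h3' := Submodule.neg_mem _ h3
  rw [neg_sub] at h1' h2' h3'
  unfold genSpan at hx hy
  induction hx using Submodule.span_induction with
  | zero => simp
  | add u v _ _ hu hv =>
    have : (u + v) * y - y * (u + v) = (u * y - y * u) + (v * y - y * v) := by noncomm_ring
    rw [this]; exact Submodule.add_mem _ hu hv
  | smul c u _ hu =>
    rw [smul_mul_assoc, mul_smul_comm, ← smul_sub]; exact Submodule.smul_mem _ _ hu
  | mem x hx =>
    induction hy using Submodule.span_induction with
    | zero => simp
    | add u v _ _ hu hv =>
      have : x * (u + v) - (u + v) * x = (x * u - u * x) + (x * v - v * x) := by noncomm_ring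
      rw [this]; exact Submodule.add_mem _ hu hv
    | smul c u _ hu =>
      rw [smul_mul_assoc, mul_smul_comm, ← smul_sub]; exact Submodule.smul_mem _ _ hu
    | mem y hy =>
      rcases hx with rfl | rfl | rfl | rfl <;> rcases hy with rfl | rfl | rfl | rfl <;>
        first | assumption | simp

/-- The filtration is stable under commutators with elements of `genSpan`. -/
lemma IsTriple.commutator_mem_genSpan_pow (t : IsTriple e f h) {x : A}
    (hx : x ∈ genSpan e f h) {n : ℕ} {y : A} (hy : y ∈ genSpan e f h ^ n) :
    x * y - y * x ∈ genSpan e f h ^ n := by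
  induction n generalizing y with
  | zero =>
    rw [pow_zero] at hy
    obtain ⟨c, rfl⟩ := Submodule.mem_one.1 hy
    simp [Algebra.commutes c x]
  | succ n ih =>
    rw [pow_succ'] at hy
    induction hy using Submodule.mul_induction_on' with
    | mem_mul_mem u hu v hv =>
      have : x * (u * v) - u * v * x = (x * u - u * x) * v + u * (x * v - v * x) := by
        noncomm_ring
      rw [this]
      exact Submodule.add_mem _
        (mul_mem_genSpan_pow (mem_genSpan_pow_one (t.commutator_mem_genSpan hx hu)) hv (by omega))
        (mul_mem_genSpan_pow (mem_genSpan_pow_one hu) (ih hv) (by omega))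
    | add u _ v _ hu hv =>
      have : x * (u + v) - (u + v) * x = (x * u - u * x) + (x * v - v * x) := by noncomm_ring
      rw [this]; exact Submodule.add_mem _ hu hv

/-- The bracket with f is a derivation sending h to 2f, so each of the l + 1 factors contributes 2 f
h^l once reordered. Reordering costs only terms of degree at most l. -/
lemma IsTriple.commutator_f_h_pow (t : IsTriple e f h) (l : ℕ) :
    f * h ^ (l + 1) - h ^ (l + 1) * f - (2 * (l + 1) : ℚ) • (f * h ^ l) ∈ genSpan e f h ^ l := by
  have hfh : f * h - h * f = (2 : ℚ) • f := by
    rw [← neg_sub, t.hf, neg_neg, two_smul, two_mul]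
  induction l with
  | zero => simp [hfh]
  | succ l ih =>
    have : f * h ^ (l + 1 + 1) - h ^ (l + 1 + 1) * f -
          (2 * ((l + 1 : ℕ) + 1) : ℚ) • (f * h ^ (l + 1)) =
        (f * h ^ (l + 1) - h ^ (l + 1) * f - (2 * (l + 1) : ℚ) • (f * h ^ l)) * h -
          (2 : ℚ) • (f * h ^ (l + 1) - h ^ (l + 1) * f) := by
      have h1 : f * h ^ (l + 1 + 1) - h ^ (l + 1 + 1) * f =
          (f * h ^ (l + 1) - h ^ (l + 1) * f) * h + h ^ (l + 1) * (f * h - h * f) := by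
        rw [pow_succ h (l + 1)]; noncomm_ring
      rw [h1, hfh, sub_mul _ ((2 * (l + 1) : ℚ) • (f * h ^ l)) h, smul_mul_assoc, mul_assoc f, ← pow_succ, mul_smul_comm]
      push_cast
      module
    rw [this]
    exact Submodule.sub_mem _
      (mul_mem_genSpan_pow ih (mem_genSpan_pow_one h_mem_genSpan) le_rfl)
      (Submodule.smul_mem _ _ (t.commutator_mem_genSpan_pow f_mem_genSpan
        (pow_mem_genSpan_pow h_mem_genSpan _)))

/-- Same derivation argument, with f bracketing e to -h. -/
lemma IsTriple.commutator_f_e_pow (t : IsTriple e f h) (k : ℕ) :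
    f * e ^ (k + 1) - e ^ (k + 1) * f + (k + 1 : ℚ) • (h * e ^ k) ∈ genSpan e f h ^ k := by
  have hfe : f * e - e * f = -h := by rw [← neg_sub, t.ef]
  induction k with
  | zero => simp [hfe]
  | succ k ih =>
    have : f * e ^ (k + 1 + 1) - e ^ (k + 1 + 1) * f +
          ((k + 1 : ℕ) + 1 : ℚ) • (h * e ^ (k + 1)) =
        (f * e ^ (k + 1) - e ^ (k + 1) * f + (k + 1 : ℚ) • (h * e ^ k)) * e +
          (h * e ^ (k + 1) - e ^ (k + 1) * h) := by
      have h1 : f * e ^ (k + 1 + 1) - e ^ (k + 1 + 1) * f =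
          (f * e ^ (k + 1) - e ^ (k + 1) * f) * e + e ^ (k + 1) * (f * e - e * f) := by
        rw [pow_succ e (k + 1)]; noncomm_ring
      rw [h1, hfe, add_mul _ _ e, smul_mul_assoc, mul_assoc h, ← pow_succ, mul_neg]
      push_cast
      module
    rw [this]
    exact Submodule.add_mem _
      (mul_mem_genSpan_pow ih (mem_genSpan_pow_one e_mem_genSpan) le_rfl)
      (t.commutator_mem_genSpan_pow h_mem_genSpan (pow_mem_genSpan_pow e_mem_genSpan _))

/-- Same argument, with e bracketing h to -2e; here the new e is collected on the right. -/
lemma IsTriple.commutator_e_h_pow (t : IsTriple e f h) (l : ℕ) :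
    e * h ^ (l + 1) - h ^ (l + 1) * e + (2 * (l + 1) : ℚ) • (h ^ l * e) ∈ genSpan e f h ^ l := by
  have heh : e * h - h * e = -((2 : ℚ) • e) := by
    rw [← neg_sub, t.he, two_smul, two_mul]
  induction l with
  | zero => simp [heh]
  | succ l ih =>
    have : e * h ^ (l + 1 + 1) - h ^ (l + 1 + 1) * e +
          (2 * ((l + 1 : ℕ) + 1) : ℚ) • (h ^ (l + 1) * e) =
        h * (e * h ^ (l + 1) - h ^ (l + 1) * e + (2 * (l + 1) : ℚ) • (h ^ l * e)) -
          (2 : ℚ) • (e * h ^ (l + 1) - h ^ (l + 1) * e) := by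
      have h1 : e * h ^ (l + 1 + 1) - h ^ (l + 1 + 1) * e =
          h * (e * h ^ (l + 1) - h ^ (l + 1) * e) + (e * h - h * e) * h ^ (l + 1) := by
        rw [pow_succ' h (l + 1)]; noncomm_ring
      rw [h1, heh, mul_add h, mul_smul_comm, ← mul_assoc h, ← pow_succ', neg_mul, smul_mul_assoc]
      push_cast
      module
    rw [this]
    exact Submodule.sub_mem _
      (mul_mem_genSpan_pow (mem_genSpan_pow_one h_mem_genSpan) ih (by omega))
      (Submodule.smul_mem _ _ (t.commutator_mem_genSpan_pow e_mem_genSpan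
        (pow_mem_genSpan_pow h_mem_genSpan _)))

/-- A monic product of `n` linear factors in `h` agrees with `h ^ n` up to lower filtration. -/
lemma prod_sub_pow_mem_genSpan_pow (c : ℕ → ℚ) (n : ℕ) :
    ((List.range (n + 1)).map fun i => h + algebraMap ℚ A (c i)).prod - h ^ (n + 1) ∈
      genSpan e f h ^ n := by
  induction n with
  | zero => simp
  | succ n ih =>
    rw [List.range_succ, List.map_append, List.prod_append, pow_succ h (n + 1)]
    set p := ((List.range (n + 1)).map fun i => h + algebraMap ℚ A (c i)).prod
    have : p * (List.map (fun i => h + algebraMap ℚ A (c i)) [n + 1]).prod - h ^ (n + 1) * h =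
        (p - h ^ (n + 1)) * h + c (n + 1) • ((p - h ^ (n + 1)) + h ^ (n + 1)) := by
      simp [Algebra.smul_def, (Algebra.commutes (c (n + 1)) p), mul_add, sub_mul]
      abel
    rw [this]
    exact Submodule.add_mem _
      (mul_mem_genSpan_pow ih (mem_genSpan_pow_one h_mem_genSpan) le_rfl)
      (Submodule.smul_mem _ _ (Submodule.add_mem _ (genSpan_pow_mono (by omega) ih)
        (pow_mem_genSpan_pow h_mem_genSpan _)))

/-- Bracketing h^(l+1) e^k with e trades one h for an e, with coefficient -2(l+1) modulo F_d. As F_d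
is stable under the bracket and the coefficient is invertible in ℚ, membership passes from k to k +
1. -/
lemma IsTriple.h_pow_mul_e_pow_mem (t : IsTriple e f h) {d : ℕ}
    (hd : h ^ (d + 1) ∈ genSpan e f h ^ d) (k l : ℕ) (hkl : l + k = d + 1) :
    h ^ l * e ^ k ∈ genSpan e f h ^ d := by
  induction k generalizing l with
  | zero => obtain rfl : l = d + 1 := by omega
            simpa using hd
  | succ k ih =>
    have h1 := t.commutator_mem_genSpan_pow e_mem_genSpan (ih (l + 1) (by omega))
    have h2 : (e * h ^ (l + 1) - h ^ (l + 1) * e + (2 * (l + 1) : ℚ) • (h ^ l * e)) * e ^ k ∈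
        genSpan e f h ^ d := mul_mem_genSpan_pow (t.commutator_e_h_pow l)
      (pow_mem_genSpan_pow e_mem_genSpan k) (by omega)
    have h3 := Submodule.smul_mem _ (2 * (l + 1) : ℚ)⁻¹ (Submodule.sub_mem _ h2 h1)
    have h0 : (2 * (l + 1) : ℚ) ≠ 0 := by positivity
    have h4 : (e * h ^ (l + 1) - h ^ (l + 1) * e + (2 * (l + 1) : ℚ) • (h ^ l * e)) * e ^ k -
        (e * (h ^ (l + 1) * e ^ k) - h ^ (l + 1) * e ^ k * e) =
        (2 * (l + 1) : ℚ) • (h ^ l * e ^ (k + 1)) := by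
      rw [add_mul, smul_mul_assoc, mul_assoc (h ^ l) e, ← pow_succ', sub_mul,
        mul_assoc (h ^ (l + 1)) _ e, mul_assoc (h ^ (l + 1)) e, ← pow_succ, ← pow_succ', mul_assoc]
      abel
    rwa [h4, inv_smul_smul₀ h0] at h3

/-- If `h ^ (d + 1)` drops in the filtration, so does each ordered monomial of degree `d + 1`. -/
lemma IsTriple.monomial_mem (t : IsTriple e f h) {d : ℕ}
    (hd : h ^ (d + 1) ∈ genSpan e f h ^ d) (j l k : ℕ) (hjlk : j + l + k = d + 1) :
    f ^ j * h ^ l * e ^ k ∈ genSpan e f h ^ d := by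
  induction j generalizing l k with
  | zero => simpa using t.h_pow_mul_e_pow_mem hd k l (by omega)
  | succ j ih =>
    -- Bracket f^j h^(l+1) e^k with f: the h-part yields the wanted monomial times 2(l+1), plus the
    -- error `h2`; the e-part is `h3`.
    have h1 := t.commutator_mem_genSpan_pow f_mem_genSpan (ih (l + 1) k (by omega))
    have hj : f ^ j ∈ genSpan e f h ^ j := pow_mem_genSpan_pow f_mem_genSpan j
    have h2 : f ^ j * (f * h ^ (l + 1) - h ^ (l + 1) * f - (2 * (l + 1) : ℚ) • (f * h ^ l)) *
        e ^ k ∈ genSpan e f h ^ d :=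
      mul_mem_genSpan_pow (mul_mem_genSpan_pow hj (t.commutator_f_h_pow l) le_rfl)
        (pow_mem_genSpan_pow e_mem_genSpan k) (by omega)
    -- Bracketing e with f gives an h, so the degree remains d + 1, but the power of f is still j
    -- and the induction hypothesis applies with h^(l+2).
    have h3 : f ^ j * h ^ (l + 1) * (f * e ^ k - e ^ k * f) ∈ genSpan e f h ^ d := by
      cases k with
      | zero => simp
      | succ k =>
        have h4 : f ^ j * h ^ (l + 1) *
            (f * e ^ (k + 1) - e ^ (k + 1) * f + (k + 1 : ℚ) • (h * e ^ k)) ∈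
              genSpan e f h ^ d :=
          mul_mem_genSpan_pow (mul_mem_genSpan_pow hj
            (pow_mem_genSpan_pow h_mem_genSpan (l + 1)) le_rfl) (t.commutator_f_e_pow k) (by omega)
        have h5 := Submodule.sub_mem _ h4
          (Submodule.smul_mem _ (k + 1 : ℚ) (ih (l + 2) k (by omega)))
        rwa [mul_add, mul_smul_comm, ← mul_assoc _ h, mul_assoc (f ^ j) _ h, ← pow_succ,
          add_sub_cancel_right] at h5
    have h0 : (2 * (l + 1) : ℚ) ≠ 0 := by positivity
    have h4 := Submodule.smul_mem _ (2 * (l + 1) : ℚ)⁻¹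
      (Submodule.sub_mem _ (Submodule.sub_mem _ h1 h2) h3)
    have h5 : f * (f ^ j * h ^ (l + 1) * e ^ k) - f ^ j * h ^ (l + 1) * e ^ k * f -
        f ^ j * (f * h ^ (l + 1) - h ^ (l + 1) * f - (2 * (l + 1) : ℚ) • (f * h ^ l)) * e ^ k -
        f ^ j * h ^ (l + 1) * (f * e ^ k - e ^ k * f) =
        (2 * (l + 1) : ℚ) • (f ^ (j + 1) * h ^ l * e ^ k) := by
      simp only [mul_sub, sub_mul, smul_mul_assoc, mul_smul_comm, ← mul_assoc, ← pow_succ,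
        ← pow_succ']
      abel
    rwa [h5, inv_smul_smul₀ h0] at h4

/-- The span of the ordered monomials of degree at most `n`. -/
def monomialSpan (e f h : A) (n : ℕ) : Submodule ℚ A :=
  Submodule.span ℚ {x | ∃ a b c : ℕ, a + b + c ≤ n ∧ f ^ a * h ^ b * e ^ c = x}

lemma monomialSpan_mono {m n : ℕ} (hmn : m ≤ n) :
    monomialSpan e f h m ≤ monomialSpan e f h n :=
  Submodule.span_mono fun _ ⟨a, b, c, h, hx⟩ => ⟨a, b, c, h.trans hmn, hx⟩

lemma monomial_mem_monomialSpan {a b c n : ℕ} (habc : a + b + c ≤ n) :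
    f ^ a * h ^ b * e ^ c ∈ monomialSpan e f h n :=
  Submodule.subset_span ⟨a, b, c, habc, rfl⟩

lemma monomial_mem_genSpan_pow (a b c : ℕ) :
    f ^ a * h ^ b * e ^ c ∈ genSpan e f h ^ (a + b + c) :=
  mul_mem_genSpan_pow (mul_mem_genSpan_pow (pow_mem_genSpan_pow f_mem_genSpan a)
    (pow_mem_genSpan_pow h_mem_genSpan b) le_rfl) (pow_mem_genSpan_pow e_mem_genSpan c) le_rfl

/-- Each filtration step is spanned by ordered monomials. -/
lemma IsTriple.genSpan_pow_le_monomialSpan (t : IsTriple e f h) (n : ℕ) :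
    genSpan e f h ^ n ≤ monomialSpan e f h n := by
  induction n with
  | zero =>
    rw [pow_zero, Submodule.one_le]
    simpa using monomial_mem_monomialSpan (e := e) (f := f) (h := h) (a := 0) (b := 0) (c := 0) le_rfl
  | succ n ih =>
    have key : ∀ a b c : ℕ, a + b + c ≤ n → ∀ x ∈ ({1, e, f, h} : Set A),
        x * (f ^ a * h ^ b * e ^ c) ∈ monomialSpan e f h (n + 1) := by
      intro a b c habc x hx
      have low : genSpan e f h ^ n ≤ monomialSpan e f h (n + 1) :=
        ih.trans (monomialSpan_mono n.le_succ)
      have ha : f ^ a ∈ genSpan e f h ^ a := pow_mem_genSpan_pow f_mem_genSpan a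
      have hb : h ^ b ∈ genSpan e f h ^ b := pow_mem_genSpan_pow h_mem_genSpan b
      have hc : e ^ c ∈ genSpan e f h ^ c := pow_mem_genSpan_pow e_mem_genSpan c
      rcases hx with rfl | rfl | rfl | rfl
      · rw [one_mul]; exact monomial_mem_monomialSpan (by omega)
      -- Here `x` is e. Moving it right past f^a h^b costs a commutator of degree at most a + b, so
      -- the error stays in F_n.
      · have : x * (f ^ a * h ^ b * x ^ c) = (x * (f ^ a * h ^ b) - f ^ a * h ^ b * x) * x ^ c +
            f ^ a * h ^ b * x ^ (c + 1) := by rw [pow_succ']; noncomm_ring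
        rw [this]
        exact Submodule.add_mem _ (low (mul_mem_genSpan_pow (t.commutator_mem_genSpan_pow
          e_mem_genSpan (mul_mem_genSpan_pow ha hb le_rfl)) hc habc))
          (monomial_mem_monomialSpan (by omega))
      · rw [← mul_assoc, ← mul_assoc, ← pow_succ']
        exact monomial_mem_monomialSpan (by omega)
      · have : x * (f ^ a * x ^ b * e ^ c) = (x * f ^ a - f ^ a * x) * x ^ b * e ^ c +
            f ^ a * x ^ (b + 1) * e ^ c := by rw [pow_succ']; noncomm_ring
        rw [this]
        exact Submodule.add_mem _ (low (mul_mem_genSpan_pow (mul_mem_genSpan_pow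
          (t.commutator_mem_genSpan_pow h_mem_genSpan ha) hb le_rfl) hc habc))
          (monomial_mem_monomialSpan (by omega))
    rw [pow_succ']
    refine (mul_le_mul' le_rfl ih).trans ?_
    rw [genSpan, monomialSpan, Submodule.span_mul_span, Submodule.span_le]
    rintro _ ⟨x, hx, _, ⟨a, b, c, habc, rfl⟩, rfl⟩
    exact key a b c habc x hx

/-- Truncating at `h ^ (d + 1)` truncates the whole filtration at level `d`. -/
lemma IsTriple.genSpan_pow_le (t : IsTriple e f h) {d : ℕ}
    (hd : h ^ (d + 1) ∈ genSpan e f h ^ d) (n : ℕ) :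
    genSpan e f h ^ n ≤ genSpan e f h ^ d := by
  -- One collapse suffices: F_(n+1) = F_1 F_n ≤ F_1 F_d = F_(d+1) ≤ F_d.
  have step : genSpan e f h ^ (d + 1) ≤ genSpan e f h ^ d := by
    refine (t.genSpan_pow_le_monomialSpan (d + 1)).trans (Submodule.span_le.2 ?_)
    rintro _ ⟨a, b, c, habc, rfl⟩
    rcases habc.eq_or_lt with heq | hlt
    · exact t.monomial_mem hd a b c heq
    · exact genSpan_pow_mono (Nat.lt_succ_iff.1 hlt) (monomial_mem_genSpan_pow a b c)
  induction n with
  | zero => exact genSpan_pow_mono (Nat.zero_le d)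
  | succ n ih =>
    rw [pow_succ']
    refine (mul_le_mul' le_rfl ih).trans ?_
    rwa [← pow_succ']

/-- If `e, f, h` generate and `h` is a root of a monic polynomial of degree `d + 1` that splits,
then the ordered monomials of degree at most `d` span. -/
lemma IsTriple.monomialSpan_eq_top (t : IsTriple e f h) (d : ℕ) (c : ℕ → ℚ)
    (hc : ((List.range (d + 1)).map fun i => h + algebraMap ℚ A (c i)).prod = 0)
    (hgen : Algebra.adjoin ℚ {e, f, h} = ⊤) : monomialSpan e f h d = ⊤ := by
  have hd : h ^ (d + 1) ∈ genSpan e f h ^ d := by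
    have := prod_sub_pow_mem_genSpan_pow (e := e) (f := f) (h := h) c d
    rwa [hc, zero_sub, Submodule.neg_mem_iff] at this
  rw [eq_top_iff]
  refine le_trans ?_ (t.genSpan_pow_le_monomialSpan d)
  rintro x -
  have hx : x ∈ Algebra.adjoin ℚ {e, f, h} := hgen ▸ Algebra.mem_top
  suffices ∃ n, x ∈ genSpan e f h ^ n from this.elim fun n hn => t.genSpan_pow_le hd n hn
  induction hx using Algebra.adjoin_induction with
  | mem x hx =>
    refine ⟨1, mem_genSpan_pow_one (Submodule.subset_span ?_)⟩
    exact Set.mem_insert_of_mem _ hx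
  | algebraMap r => exact ⟨0, by simp⟩
  | add x y _ _ hx hy =>
    obtain ⟨m, hm⟩ := hx
    obtain ⟨n, hn⟩ := hy
    exact ⟨max m n, Submodule.add_mem _ (genSpan_pow_mono (le_max_left m n) hm)
      (genSpan_pow_mono (le_max_right m n) hn)⟩
  | mul x y _ _ hx hy =>
    obtain ⟨m, hm⟩ := hx
    obtain ⟨n, hn⟩ := hy
    exact ⟨m + n, mul_mem_genSpan_pow hm hn le_rfl⟩

end Filtration

/-! ### Matrices acting on tensor space -/

section TensorAction

variable (d : ℕ)

/-- The diagonal action of a matrix, not necessarily invertible, on tensor space. -/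
def mulAction : Matrix (Fin 2) (Fin 2) ℚ →* Module.End ℚ (TensorSpace d) :=
  PiTensorProduct.mapMonoidHom.comp
    ((Pi.constMonoidHom (Fin d) (E →ₗ[ℚ] E)).comp
      (Matrix.toLinAlgEquiv' : Matrix (Fin 2) (Fin 2) ℚ ≃ₐ[ℚ] _).toMonoidHom)

lemma mulAction_apply (x : Matrix (Fin 2) (Fin 2) ℚ) :
    mulAction d x = PiTensorProduct.map fun _ : Fin d => Matrix.toLin' x := rfl

/-- The action of a matrix on the `i`-th tensor factor. -/
def siteAction (i : Fin d) : Matrix (Fin 2) (Fin 2) ℚ →* Module.End ℚ (TensorSpace d) :=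
  PiTensorProduct.mapMonoidHom.comp
    ((MonoidHom.mulSingle (fun _ : Fin d => (E →ₗ[ℚ] E)) i).comp
      (Matrix.toLinAlgEquiv' : Matrix (Fin 2) (Fin 2) ℚ ≃ₐ[ℚ] _).toMonoidHom)

variable {d}

lemma siteAction_apply (i : Fin d) (x : Matrix (Fin 2) (Fin 2) ℚ) :
    siteAction d i x = PiTensorProduct.map
      (Function.update (fun _ : Fin d => (LinearMap.id : E →ₗ[ℚ] E)) i (Matrix.toLin' x)) := rfl

lemma siteAction_add (i : Fin d) (x y : Matrix (Fin 2) (Fin 2) ℚ) :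
    siteAction d i (x + y) = siteAction d i x + siteAction d i y := by
  simp only [siteAction_apply, map_add, PiTensorProduct.map_update_add]

lemma siteAction_smul (i : Fin d) (c : ℚ) (x : Matrix (Fin 2) (Fin 2) ℚ) :
    siteAction d i (c • x) = c • siteAction d i x := by
  simp only [siteAction_apply, map_smul, PiTensorProduct.map_update_smul]

lemma siteAction_commute {i j : Fin d} (hij : i ≠ j) (x y : Matrix (Fin 2) (Fin 2) ℚ) :
    Commute (siteAction d i x) (siteAction d j y) :=
  (Pi.mulSingle_commute hij _ _).map PiTensorProduct.mapMonoidHom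

lemma lieAction_eq_sum (x : Matrix (Fin 2) (Fin 2) ℚ) :
    lieAction d x = ∑ i, siteAction d i x := rfl

lemma lieAction_add (x y : Matrix (Fin 2) (Fin 2) ℚ) :
    lieAction d (x + y) = lieAction d x + lieAction d y := by
  simp only [lieAction_eq_sum, siteAction_add, Finset.sum_add_distrib]

lemma lieAction_smul (c : ℚ) (x : Matrix (Fin 2) (Fin 2) ℚ) :
    lieAction d (c • x) = c • lieAction d x := by
  simp only [lieAction_eq_sum, siteAction_smul, Finset.smul_sum]

lemma lieAction_neg (x : Matrix (Fin 2) (Fin 2) ℚ) : lieAction d (-x) = -lieAction d x := by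
  rw [← neg_one_smul ℚ x, lieAction_smul]
  module

/-- Actions on distinct tensor factors commute, so only the diagonal terms of the double sum
survive. -/
lemma lieAction_commutator (x y : Matrix (Fin 2) (Fin 2) ℚ) :
    lieAction d x * lieAction d y - lieAction d y * lieAction d x =
      lieAction d (x * y - y * x) := by
  have hsub : lieAction d (x * y - y * x) = lieAction d (x * y) - lieAction d (y * x) := by
    have h : lieAction d (x * y - y * x) + lieAction d (y * x) = lieAction d (x * y) := by
      rw [← lieAction_add, sub_add_cancel]
    rw [← h]
    abel
  rw [hsub]
  simp only [lieAction_eq_sum, map_mul, Finset.sum_mul_sum]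
  rw [Finset.sum_comm (f := fun i j => siteAction d i y * siteAction d j x),
    ← Finset.sum_sub_distrib (f := fun i => ∑ j, siteAction d i x * siteAction d j y),
    ← Finset.sum_sub_distrib (f := fun i => siteAction d i x * siteAction d i y)]
  refine Finset.sum_congr rfl fun i _ => ?_
  rw [← Finset.sum_sub_distrib (f := fun j => siteAction d i x * siteAction d j y), Finset.sum_eq_single i]
  · intro j _ hj
    rw [(siteAction_commute hj.symm x y).eq, sub_self]
  · simp

lemma isTriple_lieAction :
    IsTriple (lieAction d !![0, 1; 0, 0]) (lieAction d !![0, 0; 1, 0])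
      (lieAction d !![1, 0; 0, -1]) where
  he := by
    rw [lieAction_commutator, two_mul, ← two_smul ℚ, ← lieAction_smul]
    congr 1
    ext i j; fin_cases i <;> fin_cases j <;> norm_num [Matrix.mul_apply]
  ef := by
    rw [lieAction_commutator]
    congr 1
    ext i j; fin_cases i <;> fin_cases j <;> norm_num [Matrix.mul_apply]
  hf := by
    rw [lieAction_commutator, two_mul, ← two_smul ℚ, ← lieAction_smul, ← lieAction_neg]
    congr 1
    ext i j; fin_cases i <;> fin_cases j <;> norm_num [Matrix.mul_apply]

/-- The unipotent element `1 + x` with `x ^ 2 = 0` acts as the exponential of `x`. -/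
lemma mulAction_one_add {x : Matrix (Fin 2) (Fin 2) ℚ} (hx : x * x = 0) :
    IsNilpotent (lieAction d x) ∧ mulAction d (1 + x) = IsNilpotent.exp (lieAction d x) := by
  have hsq (i : Fin d) : siteAction d i x ^ 2 = 0 := by
    rw [pow_two, ← map_mul, hx, ← zero_smul ℚ x, siteAction_smul, zero_smul]
  have hnil (s : Finset (Fin d)) : IsNilpotent (∑ i ∈ s, siteAction d i x) := by
    refine Commute.isNilpotent_sum (fun i _ => ⟨2, hsq i⟩) fun i j _ _ => ?_
    rcases eq_or_ne i j with rfl | hij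
    · exact Commute.refl _
    · exact siteAction_commute hij x x
  -- Induct on the set of factors acted on: the summands commute, so exponentials multiply, and each
  -- is 1 + x because its square vanishes.
  have hexp (s : Finset (Fin d)) :
      PiTensorProduct.map (fun i => if i ∈ s then Matrix.toLin' (1 + x) else 1) =
        IsNilpotent.exp (∑ i ∈ s, siteAction d i x) := by
    induction s using Finset.induction_on with
    | empty => simp
    | insert a s ha ih =>
      have hcomm : Commute (siteAction d a x) (∑ i ∈ s, siteAction d i x) :=
        Commute.sum_right _ _ _ fun i hi => siteAction_commute (by rintro rfl; exact ha hi) x x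
      rw [Finset.sum_insert ha, IsNilpotent.exp_add_of_commute hcomm ⟨2, hsq a⟩ (hnil s), ← ih,
        IsNilpotent.exp_eq_sum (hsq a)]
      have h1 : ∑ i ∈ Finset.range 2, ((i.factorial : ℚ)⁻¹) • siteAction d a x ^ i =
          siteAction d a (1 + x) := by
        simp [Finset.sum_range_succ, siteAction_add]
      rw [h1, siteAction_apply, ← PiTensorProduct.map_mul]
      congr 1
      funext i
      rcases eq_or_ne i a with rfl | hia
      · simp [ha]
      · simp only [Finset.mem_insert, hia, false_or, Function.update_of_ne hia]
        exact (one_mul _).symm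
  refine ⟨hnil Finset.univ, ?_⟩
  rw [mulAction_apply, lieAction_eq_sum, ← hexp]
  simp

/-! ### Weights, diagonal matrices and generation -/

/-- The standard basis of tensor space. -/
noncomputable def tensorBasis (d : ℕ) : Module.Basis (Fin d → Fin 2) ℚ (TensorSpace d) :=
  Basis.piTensorProduct fun _ => Pi.basisFun ℚ (Fin 2)

lemma tensorBasis_apply (I : Fin d → Fin 2) :
    tensorBasis d I = PiTensorProduct.tprod ℚ fun i => (Pi.single (I i) 1 : E) := by
  simp [tensorBasis]

lemma tensorBasis_repr_mulAction (x : Matrix (Fin 2) (Fin 2) ℚ) (I J : Fin d → Fin 2) :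
    (tensorBasis d).repr (mulAction d x (tensorBasis d J)) I = ∏ i, x (I i) (J i) := by
  rw [tensorBasis_apply, mulAction_apply, PiTensorProduct.map_tprod]
  simp [tensorBasis]

lemma mulAction_diagonal_tensorBasis (w : Fin 2 → ℚ) (I : Fin d → Fin 2) :
    mulAction d (Matrix.diagonal w) (tensorBasis d I) = (∏ i, w (I i)) • tensorBasis d I := by
  rw [tensorBasis_apply, mulAction_apply, PiTensorProduct.map_tprod, ← MultilinearMap.map_smul_univ]
  congr 1
  funext i
  simp [← Pi.single_smul]

lemma siteAction_diagonal_tensorBasis (w : Fin 2 → ℚ) (i : Fin d) (I : Fin d → Fin 2) :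
    siteAction d i (Matrix.diagonal w) (tensorBasis d I) = w (I i) • tensorBasis d I := by
  have h : w (I i) = ∏ j, if j = i then w (I j) else 1 := by simp
  rw [tensorBasis_apply, siteAction_apply, PiTensorProduct.map_tprod, h,
    ← MultilinearMap.map_smul_univ]
  congr 1
  funext j
  rcases eq_or_ne j i with rfl | hj
  · simp [← Pi.single_smul]
  · simp [hj]

/-- The number of tensor factors of a basis vector equal to the second vector of `E`. -/
def weight (I : Fin d → Fin 2) : ℕ := (Finset.univ.filter fun i => I i = 1).card

lemma weight_le (I : Fin d → Fin 2) : weight I ≤ d := by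
  simpa [weight] using Finset.card_filter_le (Finset.univ : Finset (Fin d)) fun i => I i = 1

lemma card_filter_eq_zero (I : Fin d → Fin 2) :
    (Finset.univ.filter fun i => ¬ I i = 1).card = d - weight I := by
  have := Finset.card_filter_add_card_filter_not (s := (Finset.univ : Finset (Fin d)))
    (fun i => I i = 1)
  rw [Finset.card_univ, Fintype.card_fin] at this
  unfold weight
  omega

lemma lieAction_h_tensorBasis (I : Fin d → Fin 2) :
    lieAction d !![1, 0; 0, -1] (tensorBasis d I) = (d - 2 * weight I : ℚ) • tensorBasis d I := by
  have hdiag : (!![1, 0; 0, -1] : Matrix (Fin 2) (Fin 2) ℚ) = Matrix.diagonal ![1, -1] := by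
    ext i j; fin_cases i <;> fin_cases j <;> simp
  rw [hdiag, lieAction_eq_sum, LinearMap.sum_apply]
  simp only [siteAction_diagonal_tensorBasis]
  rw [← Finset.sum_smul]
  congr 1
  have : ∀ i, (![1, -1] : Fin 2 → ℚ) (I i) = 1 - 2 * if I i = 1 then 1 else 0 := by
    intro i
    generalize I i = k
    fin_cases k <;> norm_num
  simp only [this, Finset.sum_sub_distrib, ← Finset.mul_sum, Finset.sum_boole, weight]
  simp

lemma prod_diagonal_eq (w : Fin 2 → ℚ) (I : Fin d → Fin 2) :
    ∏ i, w (I i) = w 0 ^ (d - weight I) * w 1 ^ weight I := by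
  have : ∀ i, w (I i) = if I i = 1 then w 1 else w 0 := by
    intro i
    generalize I i = k
    fin_cases k <;> simp
  simp only [this]
  rw [Finset.prod_ite, Finset.prod_const, Finset.prod_const, card_filter_eq_zero, mul_comm]
  rfl

lemma aeval_lieAction_h_tensorBasis (p : Polynomial ℚ) (I : Fin d → Fin 2) :
    Polynomial.aeval (lieAction d !![1, 0; 0, -1]) p (tensorBasis d I) =
      p.eval (d - 2 * weight I : ℚ) • tensorBasis d I :=
  Module.End.aeval_apply_of_hasEigenvector
    ⟨Module.End.mem_eigenspace_iff.2 (lieAction_h_tensorBasis I), (tensorBasis d).ne_zero I⟩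

lemma prod_lieAction_h_eq_zero (d : ℕ) :
    ((List.range (d + 1)).map fun i : ℕ => lieAction d !![1, 0; 0, -1] +
      algebraMap ℚ (Module.End ℚ (TensorSpace d)) ((d : ℚ) - 2 * (i : ℚ))).prod = 0 := by
  have h : ((List.range (d + 1)).map fun i : ℕ => lieAction d !![1, 0; 0, -1] +
      algebraMap ℚ (Module.End ℚ (TensorSpace d)) ((d : ℚ) - 2 * (i : ℚ))).prod =
      Polynomial.aeval (lieAction d !![1, 0; 0, -1]) (((List.range (d + 1)).map fun i : ℕ =>
        Polynomial.X + Polynomial.C ((d : ℚ) - 2 * (i : ℚ))).prod) := by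
    rw [map_list_prod, List.map_map]
    congr 1
    refine List.map_congr_left fun i _ => ?_
    simp only [Function.comp_apply, map_add, Polynomial.aeval_X, Polynomial.aeval_C]
  rw [h]
  refine (tensorBasis d).ext fun I => ?_
  rw [aeval_lieAction_h_tensorBasis, LinearMap.zero_apply, Polynomial.eval_list_prod,
    List.prod_eq_zero, zero_smul]
  rw [List.map_map, List.mem_map]
  -- On weight k the eigenvalue of h is d - 2k, which kills the factor h + d - 2i with i = d - k.
  refine ⟨d - weight I, List.mem_range.2 (by omega), ?_⟩
  have := weight_le I
  simp
  push_cast [this]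
  ring

/-- Diagonal matrices act as polynomials in `h`. -/
lemma mulAction_diagonal_mem (w : Fin 2 → ℚ) (S : Subalgebra ℚ (Module.End ℚ (TensorSpace d)))
    (hS : lieAction d !![1, 0; 0, -1] ∈ S) : mulAction d (Matrix.diagonal w) ∈ S := by
  -- The scalar by which diag(w) acts depends only on the weight k, and the eigenvalues d - 2k of h
  -- separate weights, so interpolation applies.
  let p := Lagrange.interpolate (Finset.range (d + 1)) (fun k : ℕ => (d - 2 * k : ℚ))
    (fun k => w 0 ^ (d - k) * w 1 ^ k)
  have hp : mulAction d (Matrix.diagonal w) =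
      Polynomial.aeval (lieAction d !![1, 0; 0, -1]) p := by
    refine (tensorBasis d).ext fun I => ?_
    rw [aeval_lieAction_h_tensorBasis, mulAction_diagonal_tensorBasis, prod_diagonal_eq]
    congr 1
    refine (Lagrange.eval_interpolate_at_node (i := weight I)
      (v := fun k : ℕ => (d - 2 * k : ℚ)) (fun k => w 0 ^ (d - k) * w 1 ^ k) ?_ ?_).symm
    · intro a _ b _ hab
      simpa using hab
    · have := weight_le I
      simp; omega
  rw [hp]
  -- Viewing h as an element of `S` makes its polynomial the image of an element of `S`.
  change Polynomial.aeval (S.val ⟨_, hS⟩) p ∈ S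
  rw [Polynomial.aeval_algHom_apply]
  exact Subtype.coe_prop _

lemma exp_mem (S : Subalgebra ℚ (Module.End ℚ (TensorSpace d))) {a : Module.End ℚ (TensorSpace d)}
    (ha : a ∈ S) : IsNilpotent.exp a ∈ S :=
  Subalgebra.sum_mem _ fun _ _ => Subalgebra.smul_mem _ (Subalgebra.pow_mem _ ha _) _

/-- A subalgebra containing the action of `𝔰𝔩₂` contains the action of every matrix. -/
lemma mulAction_mem (S : Subalgebra ℚ (Module.End ℚ (TensorSpace d)))
    (he : lieAction d !![0, 1; 0, 0] ∈ S) (hf : lieAction d !![0, 0; 1, 0] ∈ S)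
    (hh : lieAction d !![1, 0; 0, -1] ∈ S) (x : Matrix (Fin 2) (Fin 2) ℚ) :
    mulAction d x ∈ S := by
  refine Matrix.diagonal_transvection_induction (fun x => mulAction d x ∈ S) x
    (fun w _ => mulAction_diagonal_mem w S hh) ?_ fun x y hx hy => ?_
  · rintro ⟨i, j, hij, c⟩
    rw [Matrix.TransvectionStruct.toMatrix_mk, Matrix.transvection,
      (mulAction_one_add (by simp [hij.symm])).2]
    apply exp_mem
    have hs : Matrix.single i j c = c • Matrix.single i j (1 : ℚ) := by simp [Matrix.smul_single]
    rw [hs, lieAction_smul]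
    refine Subalgebra.smul_mem _ ?_ c
    have h01 : Matrix.single 0 1 1 = (!![0, 1; 0, 0] : Matrix (Fin 2) (Fin 2) ℚ) := by
      ext i j; fin_cases i <;> fin_cases j <;> simp
    have h10 : Matrix.single 1 0 1 = (!![0, 0; 1, 0] : Matrix (Fin 2) (Fin 2) ℚ) := by
      ext i j; fin_cases i <;> fin_cases j <;> simp
    fin_cases i <;> fin_cases j
    · exact absurd rfl hij
    · exact h01 ▸ he
    · exact h10 ▸ hf
    · exact absurd rfl hij
  · simp only [map_mul]
    exact Subalgebra.mul_mem _ hx hy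

lemma schurAlgebra_le (S : Subalgebra ℚ (Module.End ℚ (TensorSpace d)))
    (he : lieAction d !![0, 1; 0, 0] ∈ S) (hf : lieAction d !![0, 0; 1, 0] ∈ S)
    (hh : lieAction d !![1, 0; 0, -1] ∈ S) : schurAlgebra d ≤ S := by
  rintro _ ⟨x, rfl⟩
  induction x using MonoidAlgebra.induction_on with
  | of g =>
    have hg := mulAction_mem S he hf hh (g : Matrix (Fin 2) (Fin 2) ℚ)
    have h : groupRep d g = mulAction d (g : Matrix (Fin 2) (Fin 2) ℚ) := rfl
    rw [← h] at hg
    simpa using hg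
  | add x y hx hy => simpa using Subalgebra.add_mem _ hx hy
  | smul c x hx => simpa using Subalgebra.smul_mem _ hx c

end TensorAction

/-! ### Dimension comparisons -/

section FiniteDimensional

/-! The tensor space and the endomorphism algebra carry semiring instances in the statements below,
so these facts are stated without assuming a compatible additive group structure. -/

variable {K A B V ι : Type*} [Field K] [Semiring A] [Semiring B] [Algebra K A] [Algebra K B]
  [AddCommMonoid V] [Module K V] {φ : A →ₐ[K] B} {S : Subalgebra K B}

lemma finite_end [Module.Finite K V] : Module.Finite K (Module.End K V) := by
  let := Module.addCommMonoidToAddCommGroup K (M := V)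
  exact Module.Finite.linearMap K K V V

lemma finite_subalgebra [Module.Finite K B] (S : Subalgebra K B) : Module.Finite K S := by
  let := Algebra.semiringToRing K (A := B)
  exact inferInstanceAs (Module.Finite K (Subalgebra.toSubmodule S))

lemma card_le_finrank_of_linearIndependent_dual [Fintype ι] [Module.Finite K V]
    {L : ι → Module.Dual K V} (hL : LinearIndependent K L) :
    Fintype.card ι ≤ Module.finrank K V := by
  let := Module.addCommMonoidToAddCommGroup K (M := V)
  exact hL.fintype_card_le_finrank.trans_eq Subspace.dual_finrank_eq

variable [Module.Finite K A]

lemma finrank_le_of_le_range (hS : S ≤ φ.range) :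
    Module.finrank K S ≤ Module.finrank K A := by
  let := Algebra.semiringToRing K (A := A)
  let := Algebra.semiringToRing K (A := B)
  exact (Submodule.finrank_mono (s := Subalgebra.toSubmodule S)
    (t := LinearMap.range φ.toLinearMap) hS).trans (LinearMap.finrank_range_le φ.toLinearMap)

/-- The chain dim S ≤ dim range ≤ dim A collapses to equalities. -/
lemma range_eq_of_finrank_le (hS : S ≤ φ.range)
    (hd : Module.finrank K A ≤ Module.finrank K S) : φ.range = S := by
  let := Algebra.semiringToRing K (A := A)
  let := Algebra.semiringToRing K (A := B)
  have : Module.Finite K (Subalgebra.toSubmodule φ.range) :=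
    inferInstanceAs (Module.Finite K (LinearMap.range φ.toLinearMap))
  refine (Subalgebra.toSubmodule_injective ?_).symm
  exact Submodule.eq_of_le_of_finrank_le (S₁ := Subalgebra.toSubmodule S)
    (S₂ := Subalgebra.toSubmodule φ.range) hS
    ((LinearMap.finrank_range_le φ.toLinearMap).trans hd)

lemma injective_of_finrank_le (hS : S ≤ φ.range)
    (hd : Module.finrank K A ≤ Module.finrank K S) : Function.Injective φ := by
  let := Algebra.semiringToRing K (A := A)
  let := Algebra.semiringToRing K (A := B)
  have h := φ.toLinearMap.finrank_range_add_finrank_ker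
  have h1 : Module.finrank K S ≤ Module.finrank K (LinearMap.range φ.toLinearMap) :=
    Submodule.finrank_mono (s := Subalgebra.toSubmodule S) hS
  have h2 : Module.finrank K (LinearMap.ker φ.toLinearMap) = 0 := by omega
  exact LinearMap.ker_eq_bot.1 (Submodule.finrank_eq_zero.1 h2)

end FiniteDimensional

/-! ### The lower bound from matrix coefficients -/

section Dimension

/-- The exponents `(a, b, c)` with `a + b + c ≤ d`. -/
abbrev Exponent (d : ℕ) : Type := {p : ℕ × ℕ × ℕ // p.1 + p.2.1 + p.2.2 ≤ d}

instance Exponent.finite (d : ℕ) : Finite (Exponent d) :=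
  Set.Finite.to_subtype <|
    ((Finset.range (d + 1) ×ˢ Finset.range (d + 1) ×ˢ Finset.range (d + 1)).finite_toSet).subset
      fun p (hp : p.1 + p.2.1 + p.2.2 ≤ d) => by simp; omega

variable {d : ℕ}

/-- The matrix-entry exponents of the monomial `x₀₀ ^ a * x₀₁ ^ b * x₁₀ ^ c * x₁₁ ^ (d - a - b - c)`. -/
noncomputable def Exponent.toFinsupp (p : Exponent d) : (Fin 2 × Fin 2) →₀ ℕ :=
  Finsupp.single (0, 0) p.1.1 + Finsupp.single (0, 1) p.1.2.1 + Finsupp.single (1, 0) p.1.2.2 +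
    Finsupp.single (1, 1) (d - (p.1.1 + p.1.2.1 + p.1.2.2))

lemma Exponent.toFinsupp_injective : Function.Injective (Exponent.toFinsupp (d := d)) := by
  rintro ⟨⟨a, b, c⟩, hp⟩ ⟨⟨a', b', c'⟩, hq⟩ h
  have h1 := DFunLike.congr_fun h (0, 0)
  have h2 := DFunLike.congr_fun h (0, 1)
  have h3 := DFunLike.congr_fun h (1, 0)
  simp [toFinsupp] at h1 h2 h3
  simp [h1, h2, h3]

/-- Each monomial of degree `d` in the matrix entries is a matrix coefficient of tensor space. -/
lemma Exponent.exists_prod_eq (p : Exponent d) :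
    ∃ k : Fin d → Fin 2 × Fin 2, ∀ x : Fin 2 × Fin 2 → ℚ,
      ∏ i, x (k i) = p.toFinsupp.prod fun i n => x i ^ n := by
  obtain ⟨⟨a, b, c⟩, hp⟩ := p
  -- Spell the monomial as a word of matrix positions; `hp` keeps the subtraction from truncating,
  -- so the word has length d.
  let l : List (Fin 2 × Fin 2) := List.replicate a (0, 0) ++ List.replicate b (0, 1) ++
    List.replicate c (1, 0) ++ List.replicate (d - (a + b + c)) (1, 1)
  have hl : l.length = d := by
    simp only [l, List.length_append, List.length_replicate]
    simp only at hp
    omega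
  refine ⟨fun i => l.get (i.cast hl.symm), fun x => ?_⟩
  have h1 : ∏ i : Fin d, x (l.get (i.cast hl.symm)) = (l.map x).prod := by
    rw [← List.prod_ofFn (f := fun i : Fin d => x (l.get (i.cast hl.symm)))]
    congr 1
    refine List.ext_getElem (by simp [hl]) fun n _ _ => by simp
  rw [h1, Finsupp.prod_fintype _ _ (by simp)]
  simp [l, toFinsupp, Fintype.prod_prod_type, Fin.prod_univ_two, Finsupp.single_apply, mul_assoc]

/-- A polynomial in the matrix entries that vanishes on `GL₂` is zero. -/
lemma eq_zero_of_eval_generalLinearGroup (q : MvPolynomial (Fin 2 × Fin 2) ℚ)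
    (hq : ∀ g : GL (Fin 2) ℚ, MvPolynomial.eval (fun i => g i.1 i.2) q = 0) : q = 0 := by
  -- The product with the determinant vanishes at every matrix, singular or not; then cancel the
  -- nonzero determinant.
  have hmul : q * (Matrix.mvPolynomialX (Fin 2) (Fin 2) ℚ).det = 0 := by
    refine MvPolynomial.funext fun x => ?_
    rw [map_mul, map_zero]
    let y : Matrix (Fin 2) (Fin 2) ℚ := Matrix.of fun i j => x (i, j)
    have hdet : MvPolynomial.eval x (Matrix.mvPolynomialX (Fin 2) (Fin 2) ℚ).det = y.det := by
      simp [Matrix.det_fin_two, y]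
    rw [hdet]
    by_cases h0 : y.det = 0
    · rw [h0, mul_zero]
    · have := hq (Matrix.GeneralLinearGroup.mkOfDetNeZero y h0)
      simp [Matrix.GeneralLinearGroup.mkOfDetNeZero, y] at this
      rw [this, zero_mul]
  exact (mul_eq_zero.1 hmul).resolve_right (Matrix.det_mvPolynomialX_ne_zero (Fin 2) ℚ)

lemma mulAction_mem_schurAlgebra (g : GL (Fin 2) ℚ) :
    mulAction d (g : Matrix (Fin 2) (Fin 2) ℚ) ∈ schurAlgebra d := by
  refine ⟨MonoidAlgebra.of ℚ _ g, ?_⟩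
  have h : groupRep d g = mulAction d (g : Matrix (Fin 2) (Fin 2) ℚ) := rfl
  rw [← h]
  simp

instance tensorSpace_finite (d : ℕ) : Module.Finite ℚ (TensorSpace d) :=
  Module.Finite.of_basis (tensorBasis d)

/-- The monomials in the matrix entries bound the dimension of the Schur algebra from below. -/
lemma card_exponent_le_finrank (d : ℕ) :
    Nat.card (Exponent d) ≤ Module.finrank ℚ (schurAlgebra d) := by
  classical
  have := Fintype.ofFinite (Exponent d)
  choose k hk using fun p : Exponent d => p.exists_prod_eq
  -- The coefficient in row I and column J, where (I i, J i) is the i-th position of the word for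
  -- `p`; on a group element it evaluates the monomial.
  let L (p : Exponent d) : Module.Dual ℚ (schurAlgebra d) :=
    (((tensorBasis d).coord fun i => (k p i).1) ∘ₗ
      LinearMap.applyₗ (tensorBasis d fun i => (k p i).2)) ∘ₗ (schurAlgebra d).val.toLinearMap
  have hL (p : Exponent d) (g : GL (Fin 2) ℚ) :
      L p ⟨_, mulAction_mem_schurAlgebra g⟩ =
        MvPolynomial.eval (fun i => g i.1 i.2) (MvPolynomial.monomial p.toFinsupp (1 : ℚ)) := by
    rw [MvPolynomial.eval_monomial, one_mul, ← hk p]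
    exact tensorBasis_repr_mulAction _ _ _
  have hli : LinearIndependent ℚ L := by
    rw [Fintype.linearIndependent_iff]
    intro c hc p
    have hq := eq_zero_of_eval_generalLinearGroup
      (∑ p, c p • MvPolynomial.monomial p.toFinsupp (1 : ℚ)) fun g => by
        have := LinearMap.congr_fun hc ⟨_, mulAction_mem_schurAlgebra g⟩
        simpa [LinearMap.sum_apply, hL] using this
    have hcoeff := congrArg (MvPolynomial.coeff p.toFinsupp) hq
    simpa [MvPolynomial.coeff_sum, MvPolynomial.coeff_monomial,
      Exponent.toFinsupp_injective.eq_iff] using hcoeff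
  have : Module.Finite ℚ (Module.End ℚ (TensorSpace d)) := finite_end
  have : Module.Finite ℚ (schurAlgebra d) := finite_subalgebra _
  rw [Nat.card_eq_fintype_card]
  exact card_le_finrank_of_linearIndependent_dual hli

end Dimension

/-! ### The presented algebra and the dimension squeeze -/

section Presentation

variable (d : ℕ)

lemma Presented.mk_h : RingQuot.mkAlgHom ℚ (Rel d) Free.h = Presented.h d := rfl
lemma Presented.mk_e : RingQuot.mkAlgHom ℚ (Rel d) Free.e = Presented.e d := rfl
lemma Presented.mk_f : RingQuot.mkAlgHom ℚ (Rel d) Free.f = Presented.f d := rfl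

lemma Presented.mk_two : RingQuot.mkAlgHom ℚ (Rel d) 2 = 2 := map_ofNat _ 2

lemma Presented.isTriple :
    IsTriple (Presented.e d) (Presented.f d) (Presented.h d) where
  he := by simpa [mk_h, mk_e, mk_f, mk_two] using RingQuot.mkAlgHom_rel ℚ (Rel.he (d := d))
  ef := by simpa [mk_h, mk_e, mk_f, mk_two] using RingQuot.mkAlgHom_rel ℚ (Rel.ef (d := d))
  hf := by simpa [mk_h, mk_e, mk_f, mk_two] using RingQuot.mkAlgHom_rel ℚ (Rel.hf (d := d))

/-- In `Rel.prod` the list of indices is itself coerced to rationals through the list monad; this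
returns to a map over natural numbers. -/
lemma list_map_cast_range {α : Type*} (g : ℚ → α) (n : ℕ) :
    List.map g (do let a ← List.range n; pure (a : ℚ)) =
      (List.range n).map fun i : ℕ => g i := by
  rw [List.map_eq_flatMap (l := List.range n)]
  simp [List.map_flatMap]

lemma Presented.prod_h :
    ((List.range (d + 1)).map fun i : ℕ => Presented.h d +
      algebraMap ℚ (Presented d) ((d : ℚ) - 2 * (i : ℚ))).prod = 0 := by
  have h := RingQuot.mkAlgHom_rel ℚ (Rel.prod (d := d))
  rw [list_map_cast_range, map_list_prod, List.map_map, map_zero] at h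
  rw [← h]
  congr 1
  refine List.map_congr_left fun i _ => ?_
  simp only [Function.comp_apply, map_add, AlgHom.commutes, mk_h]

lemma Presented.adjoin_eq_top :
    Algebra.adjoin ℚ {Presented.e d, Presented.f d, Presented.h d} = ⊤ := by
  have hs : ({Presented.e d, Presented.f d, Presented.h d} : Set (Presented d)) =
      RingQuot.mkAlgHom ℚ (Rel d) '' Set.range (FreeAlgebra.ι ℚ) := by
    ext x
    constructor
    · rintro (rfl | rfl | rfl)
      exacts [⟨_, ⟨Gen.e, rfl⟩, rfl⟩, ⟨_, ⟨Gen.f, rfl⟩, rfl⟩, ⟨_, ⟨Gen.h, rfl⟩, rfl⟩]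
    · rintro ⟨_, ⟨g, rfl⟩, rfl⟩
      cases g
      exacts [Or.inl rfl, Or.inr (Or.inl rfl), Or.inr (Or.inr rfl)]
  rw [hs, ← AlgHom.map_adjoin, FreeAlgebra.adjoin_range_ι, Algebra.map_top, AlgHom.range_eq_top]
  exact RingQuot.mkAlgHom_surjective ℚ (Rel d)

/-- The ordered monomial `f ^ a * h ^ b * e ^ c`. -/
def Presented.monomial (p : Exponent d) : Presented d :=
  Presented.f d ^ p.1.1 * Presented.h d ^ p.1.2.1 * Presented.e d ^ p.1.2.2

lemma Presented.span_monomial :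
    Submodule.span ℚ (Set.range (Presented.monomial d)) = ⊤ := by
  rw [← (isTriple d).monomialSpan_eq_top d (fun i => (d : ℚ) - 2 * (i : ℚ)) (prod_h d)
    (adjoin_eq_top d), monomialSpan]
  congr 1
  ext x
  constructor
  · rintro ⟨⟨⟨a, b, c⟩, hp⟩, rfl⟩
    exact ⟨a, b, c, hp, rfl⟩
  · rintro ⟨a, b, c, hp, rfl⟩
    exact ⟨⟨⟨a, b, c⟩, hp⟩, rfl⟩

/-- The action of the generators on tensor space. -/
def genAction : Gen → Module.End ℚ (TensorSpace d)
  | Gen.e => lieAction d !![0, 1; 0, 0]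
  | Gen.f => lieAction d !![0, 0; 1, 0]
  | Gen.h => lieAction d !![1, 0; 0, -1]

lemma lift_genAction_rel {x y : Free} (hxy : Rel d x y) :
    FreeAlgebra.lift ℚ (genAction d) x = FreeAlgebra.lift ℚ (genAction d) y := by
  have he : FreeAlgebra.lift ℚ (genAction d) Free.e = lieAction d !![0, 1; 0, 0] :=
    FreeAlgebra.lift_ι_apply _ _
  have hf : FreeAlgebra.lift ℚ (genAction d) Free.f = lieAction d !![0, 0; 1, 0] :=
    FreeAlgebra.lift_ι_apply _ _
  have hh : FreeAlgebra.lift ℚ (genAction d) Free.h = lieAction d !![1, 0; 0, -1] :=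
    FreeAlgebra.lift_ι_apply _ _
  cases hxy with
  | he =>
    simp only [map_sub, map_mul, he, hh, map_ofNat]
    exact isTriple_lieAction.he
  | ef =>
    simp only [map_sub, map_mul, he, hf, hh]
    exact isTriple_lieAction.ef
  | hf =>
    simp only [map_sub, map_mul, map_neg, hf, hh, map_ofNat]
    exact isTriple_lieAction.hf
  | prod =>
    rw [list_map_cast_range, map_list_prod, List.map_map, map_zero,
      ← prod_lieAction_h_eq_zero d]
    congr 1
    refine List.map_congr_left fun i _ => ?_
    simp only [Function.comp_apply, map_add, AlgHom.commutes, hh]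

/-- The representation of the presented algebra on tensor space. -/
def Presented.action : Presented d →ₐ[ℚ] Module.End ℚ (TensorSpace d) :=
  RingQuot.liftAlgHom ℚ ⟨FreeAlgebra.lift ℚ (genAction d), fun _ _ => lift_genAction_rel d⟩

lemma Presented.action_mk (x : Free) :
    Presented.action d (RingQuot.mkAlgHom ℚ (Rel d) x) = FreeAlgebra.lift ℚ (genAction d) x :=
  RingQuot.liftAlgHom_mkAlgHom_apply _ _ _ _

lemma Presented.action_e : Presented.action d (Presented.e d) = lieAction d !![0, 1; 0, 0] :=
  (action_mk d _).trans (FreeAlgebra.lift_ι_apply _ _)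

lemma Presented.action_f : Presented.action d (Presented.f d) = lieAction d !![0, 0; 1, 0] :=
  (action_mk d _).trans (FreeAlgebra.lift_ι_apply _ _)

lemma Presented.action_h : Presented.action d (Presented.h d) = lieAction d !![1, 0; 0, -1] :=
  (action_mk d _).trans (FreeAlgebra.lift_ι_apply _ _)

lemma schurAlgebra_le_range : schurAlgebra d ≤ (Presented.action d).range :=
  schurAlgebra_le _ ⟨_, Presented.action_e d⟩ ⟨_, Presented.action_f d⟩ ⟨_, Presented.action_h d⟩

instance Presented.finite : Module.Finite ℚ (Presented d) :=
  ⟨Submodule.fg_def.2 ⟨_, Set.finite_range _, Presented.span_monomial d⟩⟩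

lemma Presented.finrank_le : Module.finrank ℚ (Presented d) ≤ Nat.card (Exponent d) := by
  have := Fintype.ofFinite (Exponent d)
  rw [Nat.card_eq_fintype_card]
  exact finrank_le_of_span_eq_top (Presented.span_monomial d)

lemma Presented.finrank_eq : Module.finrank ℚ (Presented d) = Nat.card (Exponent d) :=
  (Presented.finrank_le d).antisymm <| (card_exponent_le_finrank d).trans
    (finrank_le_of_le_range (schurAlgebra_le_range d))

lemma Presented.finrank_le_schurAlgebra :
    Module.finrank ℚ (Presented d) ≤ Module.finrank ℚ (schurAlgebra d) :=
  (Presented.finrank_le d).trans (card_exponent_le_finrank d)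

/-- That e, f, h act through the Schur algebra is not checked directly: equal dimensions force it.
-/
lemma range_action_eq : (Presented.action d).range = schurAlgebra d :=
  range_eq_of_finrank_le (schurAlgebra_le_range d) (Presented.finrank_le_schurAlgebra d)

lemma Presented.action_injective : Function.Injective (Presented.action d) :=
  injective_of_finrank_le (schurAlgebra_le_range d) (Presented.finrank_le_schurAlgebra d)

end Presentation

end SchurTwo

theorem theorem2p1 (d : ℕ) :
    (∃ φ : SchurTwo.Presented d ≃ₐ[ℚ] SchurTwo.schurAlgebra d,
      (φ (SchurTwo.Presented.e d) : Module.End ℚ (SchurTwo.TensorSpace d)) =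
          SchurTwo.lieAction d !![0, 1; 0, 0] ∧
      (φ (SchurTwo.Presented.f d) : Module.End ℚ (SchurTwo.TensorSpace d)) =
          SchurTwo.lieAction d !![0, 0; 1, 0] ∧
      (φ (SchurTwo.Presented.h d) : Module.End ℚ (SchurTwo.TensorSpace d)) =
          SchurTwo.lieAction d !![1, 0; 0, -1]) ∧
    (∃ B : Module.Basis {p : ℕ × ℕ × ℕ // p.1 + p.2.1 + p.2.2 ≤ d} ℚ (SchurTwo.Presented d),
      ∀ p, B p =
        SchurTwo.Presented.f d ^ p.1.1 * SchurTwo.Presented.h d ^ p.1.2.1 *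
          SchurTwo.Presented.e d ^ p.1.2.2) := by
  have := Fintype.ofFinite (SchurTwo.Exponent d)
  refine ⟨⟨(AlgEquiv.ofInjective _ (SchurTwo.Presented.action_injective d)).trans
    (Subalgebra.equivOfEq _ _ (SchurTwo.range_action_eq d)), SchurTwo.Presented.action_e d,
    SchurTwo.Presented.action_f d, SchurTwo.Presented.action_h d⟩,
    -- A spanning family with as many indices as the dimension is a basis, so no independence of
    -- monomials is proved by hand.
    basisOfTopLeSpanOfCardEqFinrank (SchurTwo.Presented.monomial d)
      (SchurTwo.Presented.span_monomial d).ge ?_, fun p => ?_⟩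
  · rw [SchurTwo.Presented.finrank_eq, Nat.card_eq_fintype_card]
  · rw [coe_basisOfTopLeSpanOfCardEqFinrank]
    rfl
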